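/- Let $n\ge 0$, let $R$ be a commutative ring, and let $x_{ij}=x_{ji}$ ($1\le i,j\le n$) be symmetric indeterminates (one independent indeterminate for each unordered pair $\{i,j\}$). All operators below act $R$-linearly on the polynomial ring $R[x_{ij}]$: $x_{ij}$ acts by multiplication and $\partial/\partial x_{ij}$ as the formal partial derivative. For a matrix $A=(A_{ij})$ of operators let $$\det(A)=\sum_{\sigma\in\mathcal S_n}(-1)^\sigma A_{\sigma(1)1}A_{\sigma(2)2}\cdots A_{\sigma(n)n},$$ and put $$S_{ij}=\sum_{k=1}^n(1+\delta_{jk})\,x_{ik}\frac{\partial}{\partial x_{jk}} .$$ (a) (Turnbull's identity) As operators, $$\det\bigl(S_{ij}+\delta_{ij}(n-i)\bigr)=\det(x_{ij})\cdot\det\Bigl((1+\delta_{ij})\frac{\partial}{\partial x_{ij}}\Bigr).$$ (b) Let $y_{ij}=y_{ji}$ be further symmetric indeterminates commuting with the $x_{ij}$, and let $F\mapsto F(\partial)$ be the $R$-linear map from polynomials in $x,y$ to operators with $(G(x)H(y))(\partial)=G(x)\,H(\partial/\partial x)$. Put $\Sigma_{ij}=\sum_{k}(1+\delta_{jk})x_{ik}y_{jk}$.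 A Capelli configuration $(\sigma,\varphi)$ is a permutation $\sigma\in\mathcal S_n$ together with a number $\varphi(i)\in\{1,\dots,i\}$ for each $i$ with $\sigma(i)=i$. Let $\mathcal C^m$ be the set of those for which $\sigma(k)=k$ and $\varphi(k)<k$ imply $k\ge m$. Let $\tilde\Sigma_{\sigma(i)i}=\Sigma_{\sigma(i)i}$ if $\sigma(i)\ne i$ or $\varphi(i)=i$, and $\tilde\Sigma_{\sigma(i)i}=1$ otherwise, and $$\Sigma(\sigma,\varphi,m)=\Bigl(\prod_{i=n,n-1,\dots;\ i\ge \max(m,1)}\tilde\Sigma_{\sigma(i)i}(\partial)\Bigr)\cdot\Bigl(\prod_{1\le i<m}\tilde\Sigma_{\sigma(i)i}\Bigr)(\partial),$$ where the operators in the first product are composed from left to right in decreasing order of $i$. Then for every $0\le m\le n$, $$\sum_{(\sigma,\varphi)\in\mathcal C^{m+1}}(-1)^\sigma\,\Sigma(\sigma,\varphi,m+1)=\sum_{(\sigma,\varphi)\in\mathcal C^{m}}(-1)^\sigma\,\Sigma(\sigma,\varphi,m).$$ -/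

import Mathlib

open Equiv

noncomputable section

namespace Turnbull

/-- Polynomials over `R` in the symmetric indeterminates `x_{ij} = x_{ji}`, one indeterminate for
each unordered pair `s(i, j)` of indices. -/
abbrev SymPoly (n : ℕ) (R : Type*) [CommRing R] : Type _ := MvPolynomial (Sym2 (Fin n)) R

/-- The (noncommutative) ring of `R`-linear operators on polynomials; multiplication is
composition. -/
abbrev Op (n : ℕ) (R : Type*) [CommRing R] : Type _ := Module.End R (SymPoly n R)

/-- The noncommutative determinant, expanded from left to right:
`∑_σ (-1)^σ A_{σ(1)1} A_{σ(2)2} ⋯ A_{σ(n)n}`. -/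
def ncDet {n : ℕ} {A : Type*} [Ring A] (M : Fin n → Fin n → A) : A :=
  ∑ σ : Perm (Fin n), (Perm.sign σ : ℤ) • (List.ofFn fun i => M (σ i) i).prod

variable (n : ℕ) (R : Type*) [CommRing R]

/-- The operator of multiplication by a polynomial. -/
def mulOp : SymPoly n R →ₐ[R] Op n R := Algebra.lmul R (SymPoly n R)

/-- The operator `x_{ij}`: multiplication by the indeterminate `x_{ij}`. -/
def xOp (i j : Fin n) : Op n R := mulOp n R (MvPolynomial.X s(i, j))

/-- The partial derivative `∂/∂x_e` with respect to the indeterminate of the unordered pair `e`. -/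
def dOp (e : Sym2 (Fin n)) : Op n R := (MvPolynomial.pderiv e).toLinearMap

/-- The operator `(1 + δ_{jk}) ∂/∂x_{jk}`. -/
def symD (j k : Fin n) : Op n R := (1 + if j = k then 1 else 0 : R) • dOp n R s(j, k)

/-- `S_{ij} = ∑_k (1 + δ_{jk}) x_{ik} ∂/∂x_{jk}`. -/
def S (i j : Fin n) : Op n R := ∑ k, xOp n R i k * symD n R j k

theorem dOp_comm (e f : Sym2 (Fin n)) : dOp n R e * dOp n R f = dOp n R f * dOp n R e := by
  have h : ⁅(MvPolynomial.pderiv e : Derivation R (SymPoly n R) (SymPoly n R)),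
      (MvPolynomial.pderiv f : Derivation R (SymPoly n R) (SymPoly n R))⁆ = 0 := by
    refine MvPolynomial.derivation_ext fun i => ?_
    classical
    simp [Derivation.commutator_apply, MvPolynomial.pderiv_X, Pi.single_apply, apply_ite]
  refine LinearMap.ext fun p => ?_
  have h2 := DFunLike.congr_fun h p
  rw [Derivation.commutator_apply] at h2
  exact sub_eq_zero.1 h2

/-- `H ↦ H(∂/∂x)`: the algebra homomorphism that replaces each indeterminate by the corresponding
partial derivative; it is evaluation in the commutative algebra generated by these. -/
def evalD : SymPoly n R →ₐ[R] Op n R :=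
  letI : CommRing (Algebra.adjoin R (Set.range (dOp n R))) :=
    { (inferInstance : Ring (Algebra.adjoin R (Set.range (dOp n R)))) with
      mul_comm := (Algebra.isMulCommutative_adjoin R (by
        rintro _ ⟨e, rfl⟩ _ ⟨f, rfl⟩
        exact dOp_comm n R e f)).is_comm.comm }
  (Algebra.adjoin R (Set.range (dOp n R))).val.comp
    (MvPolynomial.aeval fun e => ⟨dOp n R e, Algebra.subset_adjoin ⟨e, rfl⟩⟩)

/-- Polynomials in two commuting systems of symmetric indeterminates: `x_e` (`Sum.inl e`) and
`y_e` (`Sum.inr e`). -/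
abbrev XYPoly : Type _ := MvPolynomial (Sym2 (Fin n) ⊕ Sym2 (Fin n)) R

/-- `F ↦ F(∂)`: the `R`-linear map with `(G(x) H(y))(∂) = G(x) H(∂/∂x)`, defined on the basis of
monomials in `x` and `y`. -/
def toOp : XYPoly n R →ₗ[R] Op n R :=
  (MvPolynomial.basisMonomials (Sym2 (Fin n) ⊕ Sym2 (Fin n)) R).constr R fun d =>
    mulOp n R (MvPolynomial.monomial (Finsupp.sumFinsuppEquivProdFinsupp d).1 1) *
      evalD n R (MvPolynomial.monomial (Finsupp.sumFinsuppEquivProdFinsupp d).2 1)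

/-- `Σ_{ij} = ∑_k (1 + δ_{jk}) x_{ik} y_{jk}`. -/
def Sig (i j : Fin n) : XYPoly n R :=
  ∑ k, (1 + if j = k then 1 else 0 : R) •
    (MvPolynomial.X (Sum.inl s(i, k)) * MvPolynomial.X (Sum.inr s(j, k)))

/-- Capelli configurations `(σ, φ)`: a permutation `σ`, and for each fixed point `i` of `σ` an
index `φ(i) ≤ i`. -/
abbrev Config : Type :=
  Σ σ : Perm (Fin n), ∀ i : {i : Fin n // σ i = i}, {j : Fin n // j ≤ i.1}

/-- The set `𝒞^m` of configurations such that `σ(k) = k` and `φ(k) < k` imply `k ≥ m`. Indices are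
counted from `1` in the informal notation, so that `k : Fin n` stands for the index `k + 1`. -/
def configs (m : ℕ) : Finset (Config n) :=
  Finset.univ.filter fun c =>
    ∀ k : Fin n, ∀ h : c.1 k = k, (c.2 ⟨k, h⟩ : Fin n) < k → m ≤ (k : ℕ) + 1

variable {n}

/-- The factor `Σ̃_{σ(i)i}`: it is `Σ_{σ(i)i}` if `σ(i) ≠ i` or `φ(i) = i`, and `1` otherwise. -/
def sigTilde (c : Config n) (i : Fin n) : XYPoly n R :=
  if ∀ h : c.1 i = i, (c.2 ⟨i, h⟩ : Fin n) = i then Sig n R (c.1 i) i else 1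

/-- `Σ(σ, φ, m) = Σ̃_{σ(n)n}(∂) ⋯ Σ̃_{σ(m)m}(∂) · (Σ̃_{σ(m-1),m-1} ⋯ Σ̃_{σ(1)1})(∂)`, with indices
counted from `1` (so `i : Fin n` stands for the index `i + 1`). -/
def sigOp (c : Config n) (m : ℕ) : Op n R :=
  (((List.finRange n).reverse.filter fun i : Fin n => m ≤ i.val + 1).map
      fun i => toOp n R (sigTilde R c i)).prod *
    toOp n R (∏ i : Fin n with i.val + 1 < m, sigTilde R c i)

end Turnbull

end

noncomputable section

namespace Turnbull

open MvPolynomial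

/-! ### Normal ordering and polarization operators. -/

section

/-! Summing over `φ` at a fixed point `i` gives `S_{ii} + (i - 1)`, since `i - 1` values of `φ(i)`
contribute `1`. So both sides of (b) are signed sums of `permOp`: shifted operators on the left, a
normally ordered product on the right (`sum_configs_sigOp`).

Moving `S_{σ(p)p}` into the normally ordered part adds a polarization derivative (`S_mul_toOp`).
Together with the shift, this correction is a sum over `i < p` of terms unchanged when `σ(p)` and
`σ(i)` are exchanged (`exchangeTerm_mul_swap`), which relies on `x_{ab} = x_{ba}`. The sign of `σ`
flips, so the corrections cancel.

Iterating over all `p` equates the normally ordered `det(Σ)(∂)`, which factors because commutative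
determinants are multiplicative, with a determinant whose factors run in decreasing order with
shifts `i - 1`. Reversing the indices turns this into (a). -/

theorem derivation_finset_prod {R A ι : Type*} [CommRing R] [CommRing A] [Algebra R A]
    [DecidableEq ι] (D : Derivation R A A) (s : Finset ι) (f : ι → A) :
    D (∏ i ∈ s, f i) = ∑ i ∈ s, D (f i) * ∏ j ∈ s.erase i, f j := by
  induction s using Finset.induction_on with
  | empty => simp
  | insert a s ha ih =>
    rw [Finset.prod_insert ha, Derivation.leibniz, Finset.sum_insert ha, ih,
      Finset.erase_insert ha, smul_eq_mul, smul_eq_mul, Finset.mul_sum, add_comm,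
      mul_comm (∏ i ∈ s, f i)]
    congr 1
    refine Finset.sum_congr rfl fun i hi => ?_
    have hia : a ≠ i := fun h => ha (h ▸ hi)
    rw [Finset.erase_insert_of_ne hia, Finset.prod_insert (fun h => ha (Finset.mem_of_mem_erase h))]
    ring

variable (n : ℕ) (R : Type*) [CommRing R]

theorem evalD_X (e : Sym2 (Fin n)) : evalD n R (X e) = dOp n R e := by
  simp [evalD]

theorem toOp_rename_mul_rename (G H : SymPoly n R) :
    toOp n R (rename Sum.inl G * rename Sum.inr H) = mulOp n R G * evalD n R H := by
  induction G using MvPolynomial.induction_on' with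
  | add p q hp hq => simp only [map_add, add_mul, hp, hq]
  | monomial u a =>
    induction H using MvPolynomial.induction_on' with
    | add p q hp hq => simp only [map_add, mul_add, hp, hq]
    | monomial v b =>
      have huv : (Finsupp.mapDomain Sum.inl u + Finsupp.mapDomain Sum.inr v :
          Sym2 (Fin n) ⊕ Sym2 (Fin n) →₀ ℕ) = Finsupp.sumFinsuppEquivProdFinsupp.symm (u, v) := by
        ext x
        rcases x with x | x
        · have : Finsupp.mapDomain (Sum.inr : _ → Sym2 (Fin n) ⊕ Sym2 (Fin n)) v (Sum.inl x) = 0 :=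
            Finsupp.mapDomain_of_notMem_range _ _ (by simp)
          simp [this, Finsupp.mapDomain_apply Sum.inl_injective]
        · have : Finsupp.mapDomain (Sum.inl : _ → Sym2 (Fin n) ⊕ Sym2 (Fin n)) u (Sum.inr x) = 0 :=
            Finsupp.mapDomain_of_notMem_range _ _ (by simp)
          simp [this, Finsupp.mapDomain_apply Sum.inr_injective]
      have hb := (basisMonomials (Sym2 (Fin n) ⊕ Sym2 (Fin n)) R).constr_basis R (fun d =>
        mulOp n R (monomial (Finsupp.sumFinsuppEquivProdFinsupp d).1 1) *
          evalD n R (monomial (Finsupp.sumFinsuppEquivProdFinsupp d).2 1))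
          (Finsupp.sumFinsuppEquivProdFinsupp.symm (u, v))
      rw [coe_basisMonomials, Equiv.apply_symm_apply] at hb
      rw [rename_monomial, rename_monomial, monomial_mul, huv, ← mul_one (a * b),
        ← smul_eq_mul (a * b), ← smul_monomial, map_smul, toOp, hb]
      conv_rhs =>
        rw [← mul_one a, ← mul_one b, ← smul_eq_mul a, ← smul_eq_mul b, ← smul_monomial a,
          ← smul_monomial b, map_smul, map_smul, smul_mul_smul_comm]

/-- The products `G(x) H(y)` span additively, so additive identities need checking only there. -/
theorem xyPoly_induction {P : XYPoly n R → Prop} (hadd : ∀ F G, P F → P G → P (F + G))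
    (hmul : ∀ G H : SymPoly n R, P (rename Sum.inl G * rename Sum.inr H)) (F : XYPoly n R) :
    P F := by
  refine MvPolynomial.induction_on' F (fun d a => ?_) hadd
  have h : ∃ G H : SymPoly n R,
      (monomial d 1 : XYPoly n R) = rename Sum.inl G * rename Sum.inr H := by
    refine Finsupp.induction_linear d ⟨1, 1, by simp⟩ ?_ ?_
    · rintro d e ⟨G, H, h⟩ ⟨G', H', h'⟩
      refine ⟨G * G', H * H', ?_⟩
      rw [← mul_one (1 : R), ← monomial_mul, h, h', map_mul, map_mul]
      ring
    · rintro (x | x) k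
      · exact ⟨X x ^ k, 1, by rw [map_one (rename _), map_pow, rename_X, X_pow_eq_monomial, mul_one]⟩
      · exact ⟨1, X x ^ k, by rw [map_one (rename _), map_pow, rename_X, X_pow_eq_monomial, one_mul]⟩
  obtain ⟨G, H, h⟩ := h
  have := hmul (C a * G) H
  rwa [map_mul, rename_C, mul_assoc, ← h, C_mul_monomial, mul_one] at this

theorem toOp_X_inl_mul (e : Sym2 (Fin n)) (F : XYPoly n R) :
    toOp n R (X (Sum.inl e) * F) = mulOp n R (X e) * toOp n R F := by
  induction F using xyPoly_induction with
  | hadd F G hF hG => rw [mul_add, map_add, map_add, mul_add, hF, hG]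
  | hmul G H =>
    rw [← rename_X (R := R) Sum.inl e, ← mul_assoc, ← map_mul, toOp_rename_mul_rename,
      toOp_rename_mul_rename, map_mul, mul_assoc]

theorem dOp_mul_mulOp (e : Sym2 (Fin n)) (G : SymPoly n R) :
    dOp n R e * mulOp n R G = mulOp n R G * dOp n R e + mulOp n R (pderiv e G) := by
  refine LinearMap.ext fun p => ?_
  change pderiv e (G * p) = G * pderiv e p + pderiv e G * p
  rw [Derivation.leibniz, smul_eq_mul, smul_eq_mul, mul_comm p]

theorem dOp_mul_toOp (e : Sym2 (Fin n)) (F : XYPoly n R) :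
    dOp n R e * toOp n R F = toOp n R (X (Sum.inr e) * F + pderiv (Sum.inl e) F) := by
  classical
  induction F using xyPoly_induction with
  | hadd F G hF hG =>
    simp only [map_add, mul_add] at hF hG ⊢
    rw [hF, hG]
    abel
  | hmul G H =>
    have h0 : pderiv (Sum.inl e) (rename Sum.inr H : XYPoly n R) = 0 := by
      refine pderiv_eq_zero_of_notMem_vars fun h => ?_
      have := vars_rename Sum.inr H h
      simp at this
    have h1 : X (Sum.inr e) * (rename Sum.inl G * rename Sum.inr H : XYPoly n R) =
        rename Sum.inl G * rename Sum.inr (X e * H) := by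
      rw [map_mul, rename_X]
      ring
    have h2 : pderiv (Sum.inl e) (rename Sum.inl G * rename Sum.inr H : XYPoly n R) =
        rename Sum.inl (pderiv e G) * rename Sum.inr H := by
      rw [Derivation.leibniz, h0, smul_zero, zero_add, pderiv_rename Sum.inl_injective,
        smul_eq_mul, mul_comm]
    rw [map_add, h1, h2, toOp_rename_mul_rename, toOp_rename_mul_rename, toOp_rename_mul_rename,
      ← mul_assoc, dOp_mul_mulOp, map_mul, evalD_X, add_mul, mul_assoc]

theorem toOp_one : toOp n R 1 = 1 := by
  simpa using toOp_rename_mul_rename n R 1 1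

theorem toOp_Sig (i j : Fin n) : toOp n R (Sig n R i j) = S n R i j := by
  rw [Sig, S, map_sum]
  refine Finset.sum_congr rfl fun k _ => ?_
  rw [map_smul, ← rename_X (R := R) Sum.inl, ← rename_X (R := R) Sum.inr, toOp_rename_mul_rename,
    evalD_X, symD, xOp, mul_smul_comm]

/-- The derivation `∑_k (1 + δ_{jk}) x_{ik} ∂/∂x_{jk}` of the polynomials in `x` and `y`. -/
def polarization (i j : Fin n) : Derivation R (XYPoly n R) (XYPoly n R) :=
  ∑ k, (1 + if j = k then 1 else 0 : R) •
    ((X (Sum.inl s(i, k)) : XYPoly n R) • pderiv (Sum.inl s(j, k)))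

theorem polarization_apply (i j : Fin n) (F : XYPoly n R) :
    polarization n R i j F = ∑ k, (1 + if j = k then 1 else 0 : R) •
      ((X (Sum.inl s(i, k)) : XYPoly n R) * pderiv (Sum.inl s(j, k)) F) := by
  have h := congrFun (map_sum (Derivation.coeFnAddMonoidHom (R := R) (A := XYPoly n R)
    (M := XYPoly n R)) (fun k => (1 + if j = k then 1 else 0 : R) •
    ((X (Sum.inl s(i, k)) : XYPoly n R) • pderiv (Sum.inl s(j, k)))) Finset.univ) F
  rw [Finset.sum_apply] at h
  exact h

theorem S_mul_toOp (i j : Fin n) (F : XYPoly n R) :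
    S n R i j * toOp n R F = toOp n R (Sig n R i j * F + polarization n R i j F) := by
  rw [S, Finset.sum_mul, polarization_apply, Sig, Finset.sum_mul, ← Finset.sum_add_distrib, map_sum]
  refine Finset.sum_congr rfl fun k _ => ?_
  rw [symD, mul_smul_comm, smul_mul_assoc, mul_assoc, dOp_mul_toOp, xOp, ← toOp_X_inl_mul,
    smul_mul_assoc, ← smul_add, map_smul, mul_add, mul_assoc]

/-- The weight `1 + δ` lets the diagonal variable `x_{pp}` count once for each of its two indices,
so no special case remains. -/
theorem polarization_X_inl (a p b l : Fin n) :
    polarization n R a p (X (Sum.inl s(b, l))) =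
      (if b = p then X (Sum.inl s(a, l)) else 0) + (if l = p then X (Sum.inl s(a, b)) else 0) := by
  classical
  have h : ∀ k, (1 + if p = k then 1 else 0 : R) •
      ((X (Sum.inl s(a, k)) : XYPoly n R) * pderiv (Sum.inl s(p, k)) (X (Sum.inl s(b, l)))) =
      (if k = l then (if b = p then X (Sum.inl s(a, l)) else 0) else 0) +
        (if k = b then (if l = p then X (Sum.inl s(a, b)) else 0) else 0) := by
    intro k
    have hiff : s(b, l) = s(p, k) ↔ b = p ∧ l = k ∨ b = k ∧ l = p := by
      rw [Sym2.eq_iff]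
    simp only [pderiv_X, Pi.single_apply, Sum.inl.injEq, hiff]
    by_cases hbp : b = p <;> by_cases hlp : l = p <;> by_cases hkl : k = l <;>
      by_cases hkb : k = b <;> subst_vars <;> simp_all [eq_comm, add_smul]
  rw [polarization_apply, Finset.sum_congr rfl fun k _ => h k, Finset.sum_add_distrib]
  simp

theorem polarization_X_inr (a p : Fin n) (e : Sym2 (Fin n)) :
    polarization n R a p (X (Sum.inr e)) = 0 := by
  classical
  rw [polarization_apply]
  simp [pderiv_X]

theorem polarization_Sig (a p b i : Fin n) :
    polarization n R a p (Sig n R b i) = (if b = p then Sig n R a i else 0) +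
      (1 + if i = p then 1 else 0 : R) • (X (Sum.inl s(a, b)) * X (Sum.inr s(i, p))) := by
  rw [Sig, map_sum]
  simp only [Derivation.map_smul, Derivation.leibniz, polarization_X_inl, polarization_X_inr,
    smul_eq_mul, mul_zero, zero_add, mul_add, smul_add, Finset.sum_add_distrib]
  congr 1
  · split_ifs
    · simp [Sig, mul_comm]
    · simp
  · simp [mul_comm]

end

/-! ### Capelli configurations and the sign-reversing cancellation. -/

section

theorem list_prod_map_filter {M ι : Type*} [Monoid M] (p : ι → Bool) (f : ι → M) (l : List ι) :
    ((l.filter p).map f).prod = (l.map fun i => if p i then f i else 1).prod := by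
  induction l with
  | nil => rfl
  | cons a l ih => cases h : p a <;> simp [h, ih]

theorem reverse_finRange_filter_le {n : ℕ} (p : Fin n) :
    ((List.finRange n).reverse.filter fun i : Fin n => (p : ℕ) + 1 ≤ i.val + 1) =
      ((List.finRange n).reverse.filter fun i : Fin n => (p : ℕ) + 1 + 1 ≤ i.val + 1) ++ [p] := by
  have hs : (List.finRange n).reverse.Pairwise (· > ·) :=
    List.pairwise_reverse.2 (List.pairwise_lt_finRange n)
  have hr : ∀ q : Fin n → Bool, ((List.finRange n).reverse.filter q).Pairwise (· > ·) :=
    fun q => hs.sublist List.filter_sublist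
  have hp : (((List.finRange n).reverse.filter fun i : Fin n => (p : ℕ) + 1 + 1 ≤ i.val + 1) ++
      [p]).Pairwise (· > ·) := by
    refine List.pairwise_append.2 ⟨hr _, List.pairwise_singleton _ _, fun a ha b hb => ?_⟩
    rw [List.mem_singleton] at hb
    simp only [List.mem_filter, decide_eq_true_eq] at ha
    subst hb
    exact Fin.lt_def.2 (by omega)
  refine List.Perm.eq_of_pairwise (le := (· > ·)) (fun a b _ _ h h' => absurd h (lt_asymm h'))
    (hr _) hp ?_
  refine (List.perm_ext_iff_of_nodup ((hr _).imp fun h => ne_of_gt h)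
    (hp.imp fun h => ne_of_gt h)).2 fun a => ?_
  simp only [List.mem_filter, List.mem_append, List.mem_reverse, List.mem_finRange, true_and,
    decide_eq_true_eq, List.mem_singleton, Fin.ext_iff]
  omega

variable {n : ℕ} (R : Type*) [CommRing R]

/-- The entry `S_{σ(i)i} + δ_{σ(i)i} (i - 1)`, with indices counted from `1`. -/
def shiftedS (σ : Perm (Fin n)) (i : Fin n) : Op n R :=
  S n R (σ i) i + if σ i = i then ((i : ℕ) : Op n R) else 0

/-- The sum of the `Σ(σ, φ, m)` over the configurations `(σ, φ)` of `𝒞^m` with a given `σ`. -/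
def permOp (σ : Perm (Fin n)) (m : ℕ) : Op n R :=
  (((List.finRange n).reverse.filter fun i : Fin n => m ≤ i.val + 1).map (shiftedS R σ)).prod *
    toOp n R (∏ i : Fin n with i.val + 1 < m, Sig n R (σ i) i)

theorem natCast_mul_toOp (k : ℕ) (F : XYPoly n R) :
    (k : Op n R) * toOp n R F = toOp n R (k * F) := by
  rw [← nsmul_eq_mul, ← nsmul_eq_mul, map_nsmul]

/-- The `i`-th contribution to the difference of two consecutive `permOp`s. -/
def exchangeTerm (p i : Fin n) (σ : Perm (Fin n)) : XYPoly n R :=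
  ((if σ p = p then Sig n R (σ i) i else 0) + (if σ i = p then Sig n R (σ p) i else 0) +
      (1 + if i = p then 1 else 0 : R) • (X (Sum.inl s(σ p, σ i)) * X (Sum.inr s(i, p)))) *
    ∏ j ∈ (Finset.univ.filter fun j : Fin n => j < p).erase i, Sig n R (σ j) j

/-- The first two summands trade places, and the third is preserved because `x` is symmetric. -/
theorem exchangeTerm_mul_swap (p i : Fin n) (σ : Perm (Fin n)) :
    exchangeTerm R p i (σ * swap p i) = exchangeTerm R p i σ := by
  unfold exchangeTerm
  simp only [Perm.mul_apply, swap_apply_left, swap_apply_right]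
  congr 1
  · rw [Sym2.eq_swap (a := σ i)]
    ring
  · refine Finset.prod_congr rfl fun j hj => ?_
    rw [Finset.mem_erase, Finset.mem_filter] at hj
    rw [swap_apply_of_ne_of_ne hj.2.2.ne hj.1]

theorem shiftedS_mul_toOp (p : Fin n) (σ : Perm (Fin n)) :
    shiftedS R σ p * toOp n R (∏ i : Fin n with i < p, Sig n R (σ i) i) =
      toOp n R (Sig n R (σ p) p * ∏ i : Fin n with i < p, Sig n R (σ i) i) +
        ∑ i : Fin n with i < p, toOp n R (exchangeTerm R p i σ) := by
  -- The shift at `p` is the number of `i < p`, so it supplies one copy of the product to each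
  -- exchange term.
  have hδ : (if σ p = p then ((p : ℕ) : Op n R) else 0) *
      toOp n R (∏ i : Fin n with i < p, Sig n R (σ i) i) =
      toOp n R (∑ i : Fin n with i < p, (if σ p = p then Sig n R (σ i) i else 0) *
        ∏ j ∈ (Finset.univ.filter fun j : Fin n => j < p).erase i, Sig n R (σ j) j) := by
    split_ifs
    · rw [natCast_mul_toOp, Finset.sum_congr rfl fun i hi =>
        Finset.mul_prod_erase _ (fun j => Sig n R (σ j) j) hi, Finset.sum_const, nsmul_eq_mul,
        Finset.filter_gt_eq_Iio, Fin.card_Iio]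
    · simp
  rw [shiftedS, add_mul, S_mul_toOp, hδ, map_add, add_assoc, ← map_add, derivation_finset_prod,
    ← Finset.sum_add_distrib, map_sum]
  congr 1
  refine Finset.sum_congr rfl fun i _ => ?_
  rw [polarization_Sig, exchangeTerm]
  congr 1
  ring

theorem sum_sign_permOp_step (p : Fin n) :
    ∑ σ : Perm (Fin n), (Perm.sign σ : ℤ) • permOp R σ ((p : ℕ) + 1 + 1) =
      ∑ σ : Perm (Fin n), (Perm.sign σ : ℤ) • permOp R σ ((p : ℕ) + 1) := by
  set L : Perm (Fin n) → Op n R := fun σ =>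
    (((List.finRange n).reverse.filter fun i : Fin n => (p : ℕ) + 1 + 1 ≤ i.val + 1).map
      (shiftedS R σ)).prod with hL
  have hlt : (Finset.univ.filter fun i : Fin n => i.val + 1 < (p : ℕ) + 1) =
      Finset.univ.filter fun i : Fin n => i < p := by
    ext i
    simp
  have hle : (Finset.univ.filter fun i : Fin n => i.val + 1 < (p : ℕ) + 1 + 1) =
      insert p (Finset.univ.filter fun i : Fin n => i < p) := by
    ext i
    simp only [Finset.mem_filter, Finset.mem_univ, true_and, Finset.mem_insert, Fin.lt_def,
      Fin.ext_iff]
    omega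
  have hdiff : ∀ σ : Perm (Fin n), permOp R σ ((p : ℕ) + 1) = permOp R σ ((p : ℕ) + 1 + 1) +
      ∑ i : Fin n with i < p, L σ * toOp n R (exchangeTerm R p i σ) := by
    intro σ
    rw [permOp, permOp, reverse_finRange_filter_le, hlt, hle, Finset.prod_insert (by simp),
      List.map_append, List.prod_append, List.map_singleton, List.prod_singleton, mul_assoc,
      shiftedS_mul_toOp, mul_add, Finset.mul_sum]
  -- The factors further left involve only indices above `p`, which the swap fixes.
  have hLswap : ∀ (i : Fin n) (σ : Perm (Fin n)), i < p → L (σ * swap p i) = L σ := by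
    intro i σ hi
    simp only [hL]
    congr 1
    refine List.map_congr_left fun j hj => ?_
    simp only [List.mem_filter, decide_eq_true_eq] at hj
    rw [Fin.lt_def] at hi
    rw [shiftedS, shiftedS, Perm.mul_apply, swap_apply_of_ne_of_ne (Fin.ne_of_val_ne (by omega))
      (Fin.ne_of_val_ne (by omega))]
  simp only [hdiff, smul_add, Finset.sum_add_distrib, Finset.smul_sum]
  rw [left_eq_add, Finset.sum_comm]
  refine Finset.sum_eq_zero fun i hi => ?_
  have hip : i < p := (Finset.mem_filter.1 hi).2
  refine Finset.sum_involution (fun σ _ => σ * swap p i) (fun σ _ => ?_) (fun σ _ _ h => ?_)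
    (fun _ _ => Finset.mem_univ _) (fun σ _ => ?_)
  · rw [hLswap i σ hip, exchangeTerm_mul_swap, Perm.sign_mul, Perm.sign_swap hip.ne']
    simp
  · rw [mul_eq_left, swap_eq_one_iff] at h
    exact hip.ne' h
  · rw [mul_assoc, swap_mul_self, mul_one]

/-- The functions on the fixed points of `σ`, as families indexed by all of `Fin n`. -/
def fixedPiEquiv (σ : Perm (Fin n)) :
    (∀ i : {i : Fin n // σ i = i}, {j : Fin n // j ≤ i.1}) ≃
      ∀ i : Fin n, σ i = i → {j : Fin n // j ≤ i} where
  toFun φ i h := φ ⟨i, h⟩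
  invFun u i := u i.1 i.2
  left_inv _ := rfl
  right_inv _ := rfl

/-- At a fixed point with `m ≤ i + 1`, one choice gives `S` and the `i` smaller ones give `1`.
Otherwise only one choice is admissible. -/
theorem sum_choices (σ : Perm (Fin n)) (m : ℕ) (i : Fin n) :
    ∑ u : σ i = i → {j : Fin n // j ≤ i} with ∀ h, (u h : Fin n) < i → m ≤ (i : ℕ) + 1,
      (if m ≤ (i : ℕ) + 1 then
        if ∀ h, (u h : Fin n) = i then S n R (σ i) i else 1 else 1) =
      if m ≤ (i : ℕ) + 1 then shiftedS R σ i else 1 := by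
  by_cases hσ : σ i = i
  · let e : (σ i = i → {j : Fin n // j ≤ i}) ≃ {j : Fin n // j ≤ i} :=
      { toFun := fun u => u hσ
        invFun := fun j _ => j
        left_inv := fun _ => rfl
        right_inv := fun _ => rfl }
    by_cases hm : m ≤ (i : ℕ) + 1
    · have h1 : ∑ u : σ i = i → {j : Fin n // j ≤ i},
          (if ∀ h, (u h : Fin n) = i then S n R (σ i) i else 1) =
          ∑ j : {j : Fin n // j ≤ i}, if (j : Fin n) = i then S n R (σ i) i else 1 :=
        Fintype.sum_equiv e _ _ fun u =>
          if_congr ⟨fun h => h hσ, fun h _ => h⟩ rfl rfl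
      have h2 : ∑ j : {j : Fin n // j ≤ i}, (if (j : Fin n) = i then S n R (σ i) i else 1) =
          ∑ j ∈ Finset.Iic i, if j = i then S n R (σ i) i else 1 :=
        (Finset.sum_subtype (Finset.Iic i) (fun _ => Finset.mem_Iic)
          (fun j => if j = i then S n R (σ i) i else 1)).symm
      simp only [hm, implies_true, Finset.filter_true, if_true]
      rw [h1, h2, ← Finset.Iio_insert, Finset.sum_insert (by simp), if_pos rfl,
        Finset.sum_congr rfl fun j hj => if_neg (Finset.mem_Iio.1 hj).ne, Finset.sum_const,
        Fin.card_Iio, nsmul_one, shiftedS, if_pos hσ]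
    · have h1 : (Finset.univ.filter fun u : σ i = i → {j : Fin n // j ≤ i} =>
          ∀ h, (u h : Fin n) < i → m ≤ (i : ℕ) + 1) = {fun _ => ⟨i, le_rfl⟩} := by
        ext u
        simp only [hm, imp_false, not_lt, Finset.mem_filter, Finset.mem_univ, true_and,
          Finset.mem_singleton]
        exact ⟨fun h => funext fun h' => Subtype.ext (le_antisymm (u h').2 (h h')),
          fun h _ => by rw [h]⟩
      rw [h1, Finset.sum_singleton, if_neg hm, if_neg hm]
  · have : Unique (σ i = i → {j : Fin n // j ≤ i}) :=
      { default := fun h => absurd h hσ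
        uniq := fun u => funext fun h => absurd h hσ }
    have h1 : (Finset.univ.filter fun u : σ i = i → {j : Fin n // j ≤ i} =>
        ∀ h, (u h : Fin n) < i → m ≤ (i : ℕ) + 1) = {default} := by
      ext u
      simp [hσ, Unique.eq_default u]
    rw [h1, Finset.sum_singleton, if_pos fun h => absurd h hσ, shiftedS, if_neg hσ, add_zero]

theorem sum_configs_sigOp (m : ℕ) :
    ∑ c ∈ configs n m, (Perm.sign c.1 : ℤ) • sigOp R c m =
      ∑ σ : Perm (Fin n), (Perm.sign σ : ℤ) • permOp R σ m := by
  rw [configs, Finset.sum_filter, Fintype.sum_sigma]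
  refine Finset.sum_congr rfl fun σ _ => ?_
  rw [← Finset.sum_filter]
  dsimp only
  rw [← Finset.smul_sum]
  congr 1
  -- The product in decreasing order is multilinear in its factors, so a product of sums over the
  -- values `φ(i)` expands into a sum over `φ`.
  set M : MultilinearMap R (fun _ : Fin n => Op n R) (Op n R) :=
    (MultilinearMap.mkPiAlgebraFin R n (Op n R)).domDomCongr Fin.revPerm with hM
  have hlist : ∀ f : Fin n → Op n R,
      (((List.finRange n).reverse.filter fun i : Fin n => m ≤ i.val + 1).map f).prod =
        M fun i => if m ≤ (i : ℕ) + 1 then f i else 1 := by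
    intro f
    rw [list_prod_map_filter, hM, MultilinearMap.domDomCongr_apply,
      MultilinearMap.mkPiAlgebraFin_apply, List.finRange_reverse, List.map_map, List.ofFn_eq_map]
    simp [Function.comp_def]
  have hsum := M.map_sum_finset (α := fun i => σ i = i → {j : Fin n // j ≤ i})
    (fun i u => if m ≤ (i : ℕ) + 1 then
        if ∀ h, (u h : Fin n) = i then S n R (σ i) i else 1 else 1)
    (fun i => Finset.univ.filter fun u => ∀ h, (u h : Fin n) < i → m ≤ (i : ℕ) + 1)
  simp only [sum_choices] at hsum
  rw [permOp, hlist, hsum, Finset.sum_mul]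
  refine Finset.sum_equiv (fixedPiEquiv σ) (fun φ => ?_) fun φ hφ => ?_
  · simp [fixedPiEquiv]
  · rw [Finset.mem_filter] at hφ
    rw [sigOp, hlist]
    congr 2
    · funext i
      simp only [sigTilde, apply_ite (toOp n R), toOp_Sig, toOp_one]
      rfl
    · refine Finset.prod_congr rfl fun i hi => ?_
      -- Below `m`, membership in `configs` forces `φ(i) = i`.
      rw [sigTilde, if_pos]
      intro h
      have h1 := hφ.2 i h
      rw [Finset.mem_filter] at hi
      have h2 : ¬ (φ ⟨i, h⟩ : Fin n) < i := fun hlt => absurd (h1 hlt) (by omega)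
      exact le_antisymm (φ ⟨i, h⟩).2 (not_lt.1 h2)

end

/-! ### Factorization of the determinant and reversal of the indices. -/

section

variable (n : ℕ) (R : Type*) [CommRing R]

/-- The matrix `(x_{ij})`. -/
def xMatrix : Matrix (Fin n) (Fin n) (SymPoly n R) := Matrix.of fun i j => X s(i, j)

/-- The matrix `((1 + δ_{ij}) x_{ij})`, the symbol of `((1 + δ_{ij}) ∂/∂x_{ij})`. -/
def dMatrix : Matrix (Fin n) (Fin n) (SymPoly n R) :=
  Matrix.of fun i j => (1 + if i = j then 1 else 0 : R) • X s(i, j)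

theorem ncDet_map {A : Type*} [Ring A] (f : SymPoly n R →+* A)
    (M : Matrix (Fin n) (Fin n) (SymPoly n R)) :
    ncDet (fun i j => f (M i j)) = f M.det := by
  rw [ncDet, Matrix.det_apply, map_sum]
  refine Finset.sum_congr rfl fun σ _ => ?_
  rw [Units.smul_def, map_zsmul, ← List.prod_ofFn, map_list_prod, List.map_ofFn]
  rfl

theorem ncDet_xOp : ncDet (xOp n R) = mulOp n R (xMatrix n R).det :=
  ncDet_map n R (mulOp n R).toRingHom (xMatrix n R)

theorem ncDet_symD : ncDet (symD n R) = evalD n R (dMatrix n R).det := by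
  have h : symD n R = fun i j => evalD n R (dMatrix n R i j) := by
    funext i j
    rw [dMatrix, Matrix.of_apply, map_smul, evalD_X, symD]
  rw [h]
  exact ncDet_map n R (evalD n R).toRingHom (dMatrix n R)

theorem Sig_eq_mul_transpose :
    Matrix.of (Sig n R) = (xMatrix n R).map (rename Sum.inl) *
      ((dMatrix n R).map (rename Sum.inr)).transpose := by
  ext1 i j
  simp [Matrix.mul_apply, xMatrix, dMatrix, Sig]

theorem toOp_det_Sig :
    toOp n R (Matrix.of (Sig n R)).det = ncDet (xOp n R) * ncDet (symD n R) := by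
  have hx := (rename Sum.inl : SymPoly n R →ₐ[R] XYPoly n R).map_det (xMatrix n R)
  have hd := (rename Sum.inr : SymPoly n R →ₐ[R] XYPoly n R).map_det (dMatrix n R)
  rw [AlgHom.mapMatrix_apply] at hx hd
  rw [Sig_eq_mul_transpose, Matrix.det_mul, Matrix.det_transpose, ← hx, ← hd,
    toOp_rename_mul_rename, ncDet_xOp, ncDet_symD]

theorem sum_sign_permOp_eq (m : ℕ) (hm : m ≤ n) :
    ∑ σ : Perm (Fin n), (Perm.sign σ : ℤ) • permOp R σ (m + 1) =
      ∑ σ : Perm (Fin n), (Perm.sign σ : ℤ) • permOp R σ 1 := by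
  induction m with
  | zero => rfl
  | succ k ih => exact (sum_sign_permOp_step R ⟨k, hm⟩).trans (ih (by omega))

/-- These are the two ends of the chain: at `1` no factor is normally ordered, at `n + 1` all are.
-/
theorem sum_sign_reverse_shiftedS :
    ∑ σ : Perm (Fin n), (Perm.sign σ : ℤ) • ((List.finRange n).reverse.map (shiftedS R σ)).prod =
      ncDet (xOp n R) * ncDet (symD n R) := by
  have h := sum_sign_permOp_eq n R n le_rfl
  have h1 : ∀ σ : Perm (Fin n),
      permOp R σ 1 = ((List.finRange n).reverse.map (shiftedS R σ)).prod := by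
    intro σ
    simp [permOp, toOp_one]
  have hn : ∀ σ : Perm (Fin n), permOp R σ (n + 1) = toOp n R (∏ i, Sig n R (σ i) i) := by
    intro σ
    have hf : ((List.finRange n).reverse.filter fun i : Fin n => n + 1 ≤ i.val + 1) = [] := by
      rw [List.filter_eq_nil_iff]
      intro i _
      simp
    rw [permOp, hf, List.map_nil, List.prod_nil, one_mul, Finset.filter_true_of_mem]
    intro i _
    omega
  simp only [h1, hn] at h
  rw [← h, ← toOp_det_Sig, Matrix.det_apply, map_sum]
  refine Finset.sum_congr rfl fun σ _ => ?_
  rw [Units.smul_def, map_zsmul]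
  rfl

theorem map_rev_map_rev (e : Sym2 (Fin n)) : Sym2.map Fin.rev (Sym2.map Fin.rev e) = e := by
  rw [Sym2.map_map, Fin.rev_involutive.comp_self, Sym2.map_id, id]

/-- The renaming `x_{ij} ↦ x_{n+1-i,n+1-j}`. -/
def revRename : SymPoly n R ≃ₐ[R] SymPoly n R :=
  renameEquiv R ⟨Sym2.map Fin.rev, Sym2.map Fin.rev, map_rev_map_rev n, map_rev_map_rev n⟩

theorem revRename_X (i j : Fin n) : revRename n R (X s(i, j)) = X s(Fin.rev i, Fin.rev j) := by
  simp [revRename]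

/-- Conjugation of operators by `revRename`. -/
def revConj : Op n R ≃ₐ[R] Op n R := (revRename n R).toLinearEquiv.conjAlgEquiv R

theorem revConj_apply (T : Op n R) (p : SymPoly n R) :
    revConj n R T p = revRename n R (T ((revRename n R).symm p)) := rfl

theorem revConj_mulOp (G : SymPoly n R) :
    revConj n R (mulOp n R G) = mulOp n R (revRename n R G) := by
  refine LinearMap.ext fun p => ?_
  rw [revConj_apply]
  change revRename n R (G * (revRename n R).symm p) = revRename n R G * p
  rw [map_mul, AlgEquiv.apply_symm_apply]

theorem revConj_dOp (i j : Fin n) :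
    revConj n R (dOp n R s(i, j)) = dOp n R s(Fin.rev i, Fin.rev j) := by
  refine LinearMap.ext fun p => ?_
  obtain ⟨q, rfl⟩ := (revRename n R).surjective p
  rw [revConj_apply, AlgEquiv.symm_apply_apply]
  exact (pderiv_rename (Sym2.map.injective Fin.rev_injective) s(i, j) q).symm

theorem revConj_evalD (H : SymPoly n R) :
    revConj n R (evalD n R H) = evalD n R (revRename n R H) := by
  have h : (revConj n R).toAlgHom.comp (evalD n R) =
      (evalD n R).comp (revRename n R).toAlgHom := by
    refine MvPolynomial.algHom_ext fun e => ?_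
    induction e using Sym2.ind with
    | _ i j =>
      change revConj n R (evalD n R (X s(i, j))) = evalD n R (revRename n R (X s(i, j)))
      rw [evalD_X, revConj_dOp, revRename_X, evalD_X]
  exact DFunLike.congr_fun h H

theorem revConj_S (i j : Fin n) : revConj n R (S n R i j) = S n R (Fin.rev i) (Fin.rev j) := by
  rw [S, S, map_sum, ← Equiv.sum_comp Fin.revPerm]
  refine Finset.sum_congr rfl fun k _ => ?_
  rw [map_mul, xOp, revConj_mulOp, revRename_X, symD, map_smul, revConj_dOp, Fin.revPerm_apply,
    Fin.rev_rev]
  simp only [xOp, symD, Fin.rev_eq_iff]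

theorem revRename_det_xMatrix : revRename n R (xMatrix n R).det = (xMatrix n R).det := by
  rw [AlgEquiv.map_det, ← Matrix.det_submatrix_equiv_self Fin.revPerm (xMatrix n R)]
  congr 1
  ext1 i j
  simp [xMatrix, revRename_X]

theorem revRename_det_dMatrix : revRename n R (dMatrix n R).det = (dMatrix n R).det := by
  rw [AlgEquiv.map_det, ← Matrix.det_submatrix_equiv_self Fin.revPerm (dMatrix n R)]
  congr 1
  ext1 i j
  simp [dMatrix, revRename_X]

theorem turnbull_identity :
    ncDet (fun i j => S n R i j + (if i = j then (n : Op n R) - ((i : ℕ) + 1) else 0)) =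
      ncDet (xOp n R) * ncDet (symD n R) := by
  have h := congrArg (revConj n R) (sum_sign_reverse_shiftedS n R)
  rw [map_mul, ncDet_xOp, ncDet_symD, revConj_mulOp, revConj_evalD, revRename_det_xMatrix,
    revRename_det_dMatrix, ← ncDet_xOp, ← ncDet_symD, map_sum] at h
  rw [← h, ncDet]
  -- Conjugating `σ` by the reversal keeps its sign and turns the decreasing order into the
  -- increasing one.
  refine (Fintype.sum_equiv (Equiv.permCongr Fin.revPerm) _ _ fun σ => ?_).symm
  rw [map_zsmul, Perm.sign_permCongr, map_list_prod, List.finRange_reverse, List.map_map,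
    List.map_map, List.ofFn_eq_map]
  congr 3
  funext i
  have hcast : (((Fin.rev i : Fin n) : ℕ) : Op n R) = (n : Op n R) - ((i : ℕ) + 1) := by
    rw [Fin.val_rev, Nat.cast_sub i.2]
    push_cast
    rfl
  have hiff : (Fin.rev (σ (Fin.rev i)) = i) = (σ (Fin.rev i) = Fin.rev i) :=
    propext Fin.rev_eq_iff
  simp only [Function.comp_apply, shiftedS, map_add, revConj_S, Fin.rev_rev, Equiv.permCongr_apply,
    Fin.revPerm_symm, Fin.revPerm_apply, hiff]
  congr 1
  split_ifs with hi
  · rw [map_natCast, hcast, hi, Fin.rev_rev]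
  · rw [map_zero]

end

end Turnbull

end

/-- Turnbull's identity for operators on polynomials in symmetric indeterminates, and the summed
one-step identity over Capelli configurations. Here `i : Fin n` stands for the index `i + 1`
counted from `1`, so the diagonal correction `n - i` reads `n - (i + 1)`. -/
theorem mainTheorem4 (n : ℕ) (R : Type*) [CommRing R] :
    Turnbull.ncDet (fun i j => Turnbull.S n R i j +
        (if i = j then (n : Turnbull.Op n R) - ((i : ℕ) + 1) else 0)) =
      Turnbull.ncDet (Turnbull.xOp n R) * Turnbull.ncDet (Turnbull.symD n R) ∧
    ∀ m : ℕ, m ≤ n →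
      ∑ c ∈ Turnbull.configs n (m + 1),
          (Equiv.Perm.sign c.1 : ℤ) • Turnbull.sigOp R c (m + 1) =
        ∑ c ∈ Turnbull.configs n m,
          (Equiv.Perm.sign c.1 : ℤ) • Turnbull.sigOp R c m := by
  refine ⟨Turnbull.turnbull_identity n R, fun m hm => ?_⟩
  rw [Turnbull.sum_configs_sigOp, Turnbull.sum_configs_sigOp]
  -- Indices start at `1`, so `m = 0` and `m = 1` give the same sums.
  cases m with
  | zero => simp [Turnbull.permOp]
  | succ k => exact Turnbull.sum_sign_permOp_step R ⟨k, hm⟩
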